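/- All graphs are finite, simple and undirected. A graph on $n$ vertices is *strongly regular* with parameters $(n,k,\lambda,\mu)$ if every vertex has exactly $k$ neighbours, every two adjacent vertices have exactly $\lambda$ common neighbours, and every two distinct non-adjacent vertices have exactly $\mu$ common neighbours. An *$s$-path between $x$ and $y$* in a graph $G$ is a (not necessarily induced) subgraph of $G$ that is a path on $s$ vertices with end vertices $x$ and $y$; an *$s$-cycle* in $G$ is a (not necessarily induced) subgraph of $G$ that is a cycle on $s$ vertices. **Theorem.** Let $G$ and $H$ be strongly regular graphs with the same parameters $(n,k,\lambda,\mu)$ (possibly $G=H$). Let $x\neq y$ be vertices of $G$ and $x'\neq y'$ vertices of $H$ such that $x,y$ are adjacent in $G$ if and only if $x',y'$ are adjacent in $H$. Then: 1. for every $s\le 7$, the number of $s$-paths between $x$ and $y$ in $G$ equals the number of $s$-paths between $x'$ and $y'$ in $H$; 2. for every $3\le s\le 5$, the number of $s$-cycles of $G$ containing both $x$ and $y$ equals the number of $s$-cycles of $H$ containing both $x'$ and $y'$. In other words, these counts depend only on $s$, on the parameters $(n,k,\lambda,\mu)$, and on whether the two vertices are adjacent. -/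

import Mathlib

/-- The number of `s`-vertex paths of `G` with end vertices `x` and `y`: the number of (not
necessarily induced) subgraphs `S` of `G` for which some isomorphism from the path graph on the
vertices `0, …, s - 1` onto `S` maps the first vertex to `x` and the last vertex to `y`. -/
noncomputable def SimpleGraph.numPathsBetween {V : Type*} (G : SimpleGraph V) (s : ℕ)
    (x y : V) : ℕ :=
  Set.ncard {S : G.Subgraph | ∃ e : SimpleGraph.pathGraph s ≃g S.coe,
    (∃ i : Fin s, (i : ℕ) = 0 ∧ (e i : V) = x) ∧
    (∃ j : Fin s, (j : ℕ) + 1 = s ∧ (e j : V) = y)}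

/-- The number of `s`-cycles of `G` through both `x` and `y`: the number of (not necessarily
induced) subgraphs `S` of `G` isomorphic to the cycle graph on `s` vertices with
`x, y ∈ V(S)`. It is used only for `3 ≤ s`. -/
noncomputable def SimpleGraph.numCyclesThrough {V : Type*} (G : SimpleGraph V) (s : ℕ)
    (x y : V) : ℕ :=
  Set.ncard {S : G.Subgraph | Nonempty (SimpleGraph.cycleGraph s ≃g S.coe) ∧
    x ∈ S.verts ∧ y ∈ S.verts}

/-!
For two strongly regular graphs `G` and `H` with the same parameters, call a kernel on the vertices
of `G` and one on the vertices of `H` matched if they agree on pairs of the same type (equal,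
adjacent, non-adjacent). Matched kernels are closed under entrywise products and, because the
intersection numbers depend only on the parameters (`IsSRGWith.exists_equiv`), under matrix
products (`Matched.sum_mul`).

Consider a sum, over all maps from the vertices of a small pattern to those of `G` with prescribed
images `x` and `y` of two roots, of a product of kernels along the edges of the pattern. Summing out
a vertex with at most two neighbours replaces it by one edge, by closure under both products
(`KernelProduct.sum_update`). If repeating this reaches a pattern on the two roots, then the sum
depends only on the type of `(x, y)` (`sum_rootedMaps_eq_of_reducesTo`). This happens exactly when
the pattern, with an edge between the roots, has no `K₄` minor.

The number of homomorphisms of a pattern that are constant on the classes of an equivalence relation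
is such a sum, for the quotient pattern. By Möbius inversion over the equivalence relations, the
number of injective homomorphisms is therefore determined as soon as all quotients can be reduced
(`card_injective_rootedHoms_eq`). This holds for paths on at most seven vertices, since a quotient of
a closed walk of length at most seven has no `K₄` minor (`allQuotientsReduce_pathPattern`), and for
cycles of length at most five with any two roots (`allQuotientsReduce_cyclePattern`). Dividing by the
number of automorphisms that preserve the marking turns injective homomorphisms into subgraphs
(`card_copies_eq_mul_ncard`).
-/

namespace SimpleGraph

/-! ### Types of pairs and intersection numbers -/

section PairType

variable {V W : Type*} (G : SimpleGraph V) (H : SimpleGraph W)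

open Classical in
/-- The type of an ordered pair of vertices: `0` if they are equal, `1` if they are adjacent and
`2` if they are distinct and non-adjacent. -/
noncomputable def pairType (u v : V) : Fin 3 :=
  if u = v then 0 else if G.Adj u v then 1 else 2

lemma pairType_eq_zero {u v : V} : G.pairType u v = 0 ↔ u = v := by
  unfold pairType; split_ifs <;> simp_all

lemma pairType_eq_one {u v : V} : G.pairType u v = 1 ↔ G.Adj u v := by
  unfold pairType; split_ifs with h <;> simp_all

lemma pairType_comm (u v : V) : G.pairType u v = G.pairType v u := by
  classical
  unfold pairType
  exact if_congr eq_comm rfl (if_congr (G.adj_comm u v) rfl rfl)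

variable [Fintype V] [Fintype W]

open Classical in
/-- The number of `z` such that `(u, z)` has type `i` and `(z, v)` has type `j`. -/
noncomputable def interCount (u v : V) (i j : Fin 3) : ℕ :=
  (Finset.univ.filter fun z => G.pairType u z = i ∧ G.pairType z v = j).card

lemma interCount_comm (u v : V) (i j : Fin 3) : G.interCount u v i j = G.interCount v u j i := by
  unfold interCount
  congr 1
  ext z
  simp only [Finset.mem_filter, Finset.mem_univ, true_and, G.pairType_comm u z,
    G.pairType_comm z v, and_comm]

lemma interCount_zero_left (u v : V) (j : Fin 3) :
    G.interCount u v 0 j = if G.pairType u v = j then 1 else 0 := by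
  classical
  unfold interCount
  split_ifs with h
  · rw [Finset.card_eq_one]
    refine ⟨u, ?_⟩
    ext z
    simp only [Finset.mem_filter, Finset.mem_univ, true_and, pairType_eq_zero,
      Finset.mem_singleton]
    constructor
    · exact fun h => h.1.symm
    · rintro rfl
      exact ⟨rfl, h⟩
  · rw [Finset.card_eq_zero, Finset.filter_eq_empty_iff]
    rintro z - ⟨h1, h2⟩
    rw [pairType_eq_zero] at h1
    exact h (h1 ▸ h2)

open Classical in
/-- The number of vertices at type `i` from `u`. -/
noncomputable def valency (u : V) (i : Fin 3) : ℕ :=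
  (Finset.univ.filter fun z => G.pairType u z = i).card

lemma interCount_row_sum (u v : V) (i : Fin 3) :
    G.interCount u v i 0 + G.interCount u v i 1 + G.interCount u v i 2 = G.valency u i := by
  classical
  have := Finset.card_eq_sum_card_fiberwise (f := fun z => G.pairType z v)
    (s := Finset.univ.filter fun z => G.pairType u z = i) (t := Finset.univ)
    (fun _ _ => Finset.mem_coe.2 (Finset.mem_univ _))
  rw [valency, this, Fin.sum_univ_three]
  simp only [interCount, Finset.filter_filter]

lemma valency_sum (u : V) :
    G.valency u 0 + G.valency u 1 + G.valency u 2 = Fintype.card V := by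
  classical
  have := Finset.card_eq_sum_card_fiberwise (f := fun z => G.pairType u z)
    (s := (Finset.univ : Finset V)) (t := Finset.univ)
    (fun _ _ => Finset.mem_coe.2 (Finset.mem_univ _))
  rw [← Finset.card_univ, this, Fin.sum_univ_three]
  rfl

lemma valency_zero (u : V) : G.valency u 0 = 1 := by
  classical
  rw [valency, Finset.card_eq_one]
  exact ⟨u, by ext z; simp [pairType_eq_zero, eq_comm (a := u)]⟩

variable {G H}

lemma IsSRGWith.valency_one {G : SimpleGraph V} [DecidableRel G.Adj] {n k l m : ℕ}
    (hG : G.IsSRGWith n k l m) (u : V) : G.valency u 1 = k := by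
  classical
  rw [valency, ← hG.regular u, ← G.card_neighborFinset_eq_degree]
  congr 1
  ext z
  simp [pairType_eq_one]

lemma IsSRGWith.interCount_one_one {G : SimpleGraph V} [DecidableRel G.Adj] {n k l m : ℕ}
    (hG : G.IsSRGWith n k l m) (u v : V) :
    G.interCount u v 1 1 = ![k, l, m] (G.pairType u v) := by
  classical
  by_cases huv : u = v
  · subst huv
    rw [(pairType_eq_zero G).2 rfl, ← hG.valency_one u, interCount, valency]
    simp only [G.pairType_comm _ u, and_self, Matrix.cons_val_zero]
  · have key : G.interCount u v 1 1 = Fintype.card (G.commonNeighbors u v) := by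
      rw [interCount, Fintype.card_subtype]
      congr 1
      ext z
      simp [pairType_eq_one, mem_commonNeighbors, G.adj_comm v]
    by_cases h : G.Adj u v
    · rw [(pairType_eq_one G).2 h, key]
      exact hG.of_adj u v h
    · rw [key, pairType, if_neg huv, if_neg h]
      exact hG.of_not_adj huv h

/-- The intersection numbers are determined by the parameters and the type of the pair. -/
lemma IsSRGWith.interCount_eq [DecidableRel G.Adj] [DecidableRel H.Adj] {n k l m : ℕ}
    (hG : G.IsSRGWith n k l m) (hH : H.IsSRGWith n k l m) {u v : V} {u' v' : W}
    (h : G.pairType u v = H.pairType u' v') (i j : Fin 3) :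
    G.interCount u v i j = H.interCount u' v' i j := by
  have h' : G.pairType v u = H.pairType v' u' := by
    rw [G.pairType_comm, h, H.pairType_comm]
  have left (j) : G.interCount u v 0 j = H.interCount u' v' 0 j := by
    rw [interCount_zero_left, interCount_zero_left, h]
  have right (i) : G.interCount u v i 0 = H.interCount u' v' i 0 := by
    rw [interCount_comm, H.interCount_comm, interCount_zero_left, interCount_zero_left, h']
  have mid : G.interCount u v 1 1 = H.interCount u' v' 1 1 := by
    rw [hG.interCount_one_one, hH.interCount_one_one, h]
  have r1 := G.interCount_row_sum u v 1
  have r1' := H.interCount_row_sum u' v' 1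
  have c1 := G.interCount_row_sum v u 1
  have c1' := H.interCount_row_sum v' u' 1
  have r2 := G.interCount_row_sum u v 2
  have r2' := H.interCount_row_sum u' v' 2
  simp only [hG.valency_one, hH.valency_one] at r1 r1' c1 c1'
  rw [G.interCount_comm v u, G.interCount_comm v u, G.interCount_comm v u] at c1
  rw [H.interCount_comm v' u', H.interCount_comm v' u', H.interCount_comm v' u'] at c1'
  have w := G.valency_sum u
  have w' := H.valency_sum u'
  rw [valency_zero, hG.valency_one, hG.card] at w
  rw [valency_zero, hH.valency_one, hH.card] at w'
  have l1 := left 1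
  have q1 := right 1
  have q2 := right 2
  -- the remaining intersection numbers follow from the row and column sums
  have e12 : G.interCount u v 1 2 = H.interCount u' v' 1 2 := by omega
  have e21 : G.interCount u v 2 1 = H.interCount u' v' 2 1 := by omega
  have e22 : G.interCount u v 2 2 = H.interCount u' v' 2 2 := by omega
  fin_cases i
  · exact left j
  · fin_cases j <;> assumption
  · fin_cases j <;> assumption

/-- Two pairs of the same type see the remaining vertices in the same way. -/
lemma IsSRGWith.exists_equiv [DecidableRel G.Adj] [DecidableRel H.Adj] {n k l m : ℕ}
    (hG : G.IsSRGWith n k l m) (hH : H.IsSRGWith n k l m) {u v : V} {u' v' : W}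
    (h : G.pairType u v = H.pairType u' v') :
    ∃ σ : V ≃ W, ∀ z, G.pairType u z = H.pairType u' (σ z) ∧
      G.pairType z v = H.pairType (σ z) v' := by
  classical
  have e (c : Fin 3 × Fin 3) : Nonempty ({z // (G.pairType u z, G.pairType z v) = c} ≃
      {z // (H.pairType u' z, H.pairType z v') = c}) := by
    rw [← Fintype.card_eq]
    simpa [Fintype.card_subtype, Prod.ext_iff, interCount] using hG.interCount_eq hH h c.1 c.2
  let σ := Equiv.ofFiberEquiv fun c => (e c).some
  refine ⟨σ, fun z => ?_⟩
  have := Equiv.ofFiberEquiv_map (fun c => (e c).some) z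
  exact ⟨(congrArg Prod.fst this).symm, (congrArg Prod.snd this).symm⟩

end PairType

/-! ### Matched kernels and products of kernels -/

section Matched

variable {V W : Type*} (G : SimpleGraph V) (H : SimpleGraph W)

/-- Two kernels, on the vertices of `G` and of `H`, are matched if they take the same value on
pairs of the same type. For strongly regular graphs, these are the elements of the two
Bose–Mesner algebras that have the same coordinates. -/
def Matched (K : V → V → ℤ) (K' : W → W → ℤ) : Prop :=
  ∀ ⦃u v u' v'⦄, G.pairType u v = H.pairType u' v' → K u v = K' u' v'

variable {G H}

namespace Matched

variable {K L : V → V → ℤ} {K' L' : W → W → ℤ}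

lemma one : Matched G H (fun _ _ => 1) (fun _ _ => 1) := fun _ _ _ _ _ => rfl

lemma mul (h : Matched G H K K') (h' : Matched G H L L') :
    Matched G H (fun u v => K u v * L u v) (fun u v => K' u v * L' u v) :=
  fun _ _ _ _ e => by simp only [h e, h' e]

lemma swap (h : Matched G H K K') : Matched G H (fun u v => K v u) (fun u v => K' v u) :=
  fun u v u' v' e => h (by rw [G.pairType_comm, e, H.pairType_comm])

lemma diag (h : Matched G H K K') : Matched G H (fun u _ => K u u) (fun u _ => K' u u) :=
  fun _ _ _ _ _ => h (by rw [(pairType_eq_zero G).2 rfl, (pairType_eq_zero H).2 rfl])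

/-- The series composition: matched kernels are closed under matrix multiplication. -/
lemma sum_mul [Fintype V] [Fintype W] [DecidableRel G.Adj] [DecidableRel H.Adj] {n k l m : ℕ}
    (hG : G.IsSRGWith n k l m) (hH : H.IsSRGWith n k l m)
    (h : Matched G H K K') (h' : Matched G H L L') :
    Matched G H (fun u v => ∑ z, K z u * L z v) (fun u v => ∑ z, K' z u * L' z v) := by
  intro u v u' v' e
  obtain ⟨σ, hσ⟩ := hG.exists_equiv hH e
  refine Fintype.sum_equiv σ _ _ fun z => ?_
  rw [h' (hσ z).2]
  exact congrArg (· * _) (h.swap (hσ z).1)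

open Classical in
lemma eq : Matched G H (fun u v => if u = v then 1 else 0) (fun u v => if u = v then 1 else 0) := by
  intro u v u' v' e
  simp only [← pairType_eq_zero G, ← pairType_eq_zero H, e]

open Classical in
lemma adj : Matched G H (fun u v => if G.Adj u v then 1 else 0)
    (fun u v => if H.Adj u v then 1 else 0) := by
  intro u v u' v' e
  simp only [← pairType_eq_one G, ← pairType_eq_one H, e]

end Matched

variable {Q : Type*}

variable (G H) in
/-- `KernelProduct G H E F F'` says that `F` and `F'` are products, over the edges `(i, j)` of the
pattern `E`, of matched kernels evaluated at the images of `i` and `j`. -/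
inductive KernelProduct : List (Q × Q) → ((Q → V) → ℤ) → ((Q → W) → ℤ) → Prop
  | nil : KernelProduct [] (fun _ => 1) (fun _ => 1)
  | cons {K K' E F F'} (i j : Q) (hK : Matched G H K K') (hF : KernelProduct E F F') :
      KernelProduct ((i, j) :: E) (fun g => K (g i) (g j) * F g) (fun g => K' (g i) (g j) * F' g)

/-- The edge `e` of a pattern contains the vertex `v`. -/
def touches [DecidableEq Q] (v : Q) (e : Q × Q) : Bool := decide (e.1 = v) || decide (e.2 = v)

namespace KernelProduct

variable {E E' : List (Q × Q)} {F R : (Q → V) → ℤ} {F' R' : (Q → W) → ℤ}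

lemma append (h : KernelProduct G H E F F') (h' : KernelProduct G H E' R R') :
    KernelProduct G H (E ++ E') (fun g => F g * R g) (fun g => F' g * R' g) := by
  induction h with
  | nil => simpa using h'
  | cons i j hK hF ih => simpa [mul_assoc] using ih.cons i j hK

/-- A kernel product only depends on the types of the pairs of images of the vertices that occur
in the pattern. -/
lemma eq_of_pairType (h : KernelProduct G H E F F') {g : Q → V} {g' : Q → W}
    (hg : ∀ e ∈ E, G.pairType (g e.1) (g e.2) = H.pairType (g' e.1) (g' e.2)) :
    F g = F' g' := by
  induction h with
  | nil => rfl
  | cons i j hK hF ih =>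
    have h1 := hK (hg _ List.mem_cons_self)
    have h2 := ih fun e he => hg e (List.mem_cons_of_mem _ he)
    simp only at h1 ⊢
    rw [h1, h2]

variable [DecidableEq Q] {v : Q}

lemma update_eq (h : KernelProduct G H E F F') (hv : ∀ e ∈ E, touches v e = false) :
    (∀ g z, F (Function.update g v z) = F g) ∧ ∀ g z, F' (Function.update g v z) = F' g := by
  induction h with
  | nil => exact ⟨fun _ _ => rfl, fun _ _ => rfl⟩
  | cons i j hK hF ih =>
    have h1 := hv _ List.mem_cons_self
    simp only [touches, Bool.or_eq_false_iff, decide_eq_false_iff_not] at h1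
    obtain ⟨ih1, ih2⟩ := ih fun e he => hv e (List.mem_cons_of_mem _ he)
    exact ⟨fun g z => by simp only [Function.update_of_ne h1.1, Function.update_of_ne h1.2, ih1],
      fun g z => by simp only [Function.update_of_ne h1.1, Function.update_of_ne h1.2, ih2]⟩

/-- If all neighbours of `v` are among `p` and `q`, then the factors at `v` combine into one kernel
between `v` and `p` and one between `v` and `q`. -/
lemma split (h : KernelProduct G H E F F') {p q : Q}
    (hv : ∀ e ∈ E, touches v e → (e.1 = v ∨ e.1 = p ∨ e.1 = q) ∧ (e.2 = v ∨ e.2 = p ∨ e.2 = q)) :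
    ∃ C C' D D' R R', Matched G H C C' ∧ Matched G H D D' ∧
      KernelProduct G H (E.filter fun e => !touches v e) R R' ∧
      (∀ g, F g = C (g v) (g p) * D (g v) (g q) * R g) ∧
      ∀ g, F' g = C' (g v) (g p) * D' (g v) (g q) * R' g := by
  induction h with
  | nil =>
    exact ⟨_, _, _, _, _, _, .one, .one, .nil, fun _ => by simp, fun _ => by simp⟩
  | @cons K K' E F F' i j hK hF ih =>
    obtain ⟨C, C', D, D', R, R', hC, hD, hR, e, e'⟩ :=
      ih fun e he => hv e (List.mem_cons_of_mem _ he)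
    by_cases ht : touches v (i, j) = true
    · rw [List.filter_cons_of_neg (by simp [ht])]
      have key := hv _ List.mem_cons_self ht
      simp only [touches, Bool.or_eq_true, decide_eq_true_eq] at ht key
      rcases ht with rfl | rfl
      · rcases key.2 with rfl | rfl | rfl
        · exact ⟨_, _, _, _, _, _, hK.diag.mul hC, hD, hR, fun g => by simp only [e]; ring,
            fun g => by simp only [e']; ring⟩
        · exact ⟨_, _, _, _, _, _, hK.mul hC, hD, hR, fun g => by simp only [e]; ring,
            fun g => by simp only [e']; ring⟩
        · exact ⟨_, _, _, _, _, _, hC, hK.mul hD, hR, fun g => by simp only [e]; ring,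
            fun g => by simp only [e']; ring⟩
      · rcases key.1 with rfl | rfl | rfl
        · exact ⟨_, _, _, _, _, _, hK.diag.mul hC, hD, hR, fun g => by simp only [e]; ring,
            fun g => by simp only [e']; ring⟩
        · exact ⟨_, _, _, _, _, _, hK.swap.mul hC, hD, hR, fun g => by simp only [e]; ring,
            fun g => by simp only [e']; ring⟩
        · exact ⟨_, _, _, _, _, _, hC, hK.swap.mul hD, hR, fun g => by simp only [e]; ring,
            fun g => by simp only [e']; ring⟩
    · rw [List.filter_cons_of_pos (by simpa using ht)]
      exact ⟨C, C', D, D', _, _, hC, hD, hR.cons i j hK, fun g => by simp only [e]; ring,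
        fun g => by simp only [e']; ring⟩

/-- Summing out a vertex with at most two neighbours `p` and `q` gives a kernel product again, on
the pattern in which `v` is replaced by the edge `(p, q)`. -/
lemma sum_update [Fintype V] [Fintype W] [DecidableRel G.Adj] [DecidableRel H.Adj]
    {n k l m : ℕ} (hG : G.IsSRGWith n k l m) (hH : H.IsSRGWith n k l m)
    (h : KernelProduct G H E F F') {p q : Q} (hp : p ≠ v) (hq : q ≠ v)
    (hv : ∀ e ∈ E, touches v e → (e.1 = v ∨ e.1 = p ∨ e.1 = q) ∧ (e.2 = v ∨ e.2 = p ∨ e.2 = q)) :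
    KernelProduct G H ((p, q) :: E.filter fun e => !touches v e)
      (fun g => ∑ z, F (Function.update g v z)) (fun g => ∑ z, F' (Function.update g v z)) := by
  obtain ⟨C, C', D, D', R, R', hC, hD, hR, e, e'⟩ := h.split hv
  obtain ⟨hu, hu'⟩ := hR.update_eq (v := v) fun e he => by simpa using (List.mem_filter.1 he).2
  simp only [e, e', Function.update_self, Function.update_of_ne hp, Function.update_of_ne hq,
    hu, hu', ← Finset.sum_mul]
  exact hR.cons p q (hC.sum_mul hG hH hD)

end KernelProduct

end Matched

/-! ### Elimination of vertices of degree at most two -/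

section Elimination

variable {Q : Type*} [DecidableEq Q]

/-- The vertices of the pattern `E` other than `v` that lie on an edge with `v`. -/
def patternNeighbors (v : Q) (E : List (Q × Q)) : List Q :=
  (((E.filter (touches v)).flatMap fun e => [e.1, e.2]).filter fun w => decide (w ≠ v)).dedup

/-- Whether `f` steps, each of which replaces a vertex of `vs` other than `a` and `b` with at most
two neighbours by an edge between these neighbours, greedily lead from the pattern `E` to a pattern
on the vertices `a` and `b` alone. A vertex with one neighbour is replaced by a loop there, and an
isolated vertex by a loop at `a`. -/
def reducesTo (a b : Q) : ℕ → List Q → List (Q × Q) → Bool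
  | 0, _, E => E.all fun e =>
      (decide (e.1 = a) || decide (e.1 = b)) && (decide (e.2 = a) || decide (e.2 = b))
  | f + 1, vs, E =>
    match vs.find? fun v =>
      decide (v ≠ a) && decide (v ≠ b) && decide ((patternNeighbors v E).length ≤ 2) with
    | none => false
    | some v => reducesTo a b f (vs.erase v)
        (((patternNeighbors v E).headD a, (patternNeighbors v E).getLastD a) ::
          E.filter fun e => !touches v e)

lemma mem_patternNeighbors {v w : Q} {E : List (Q × Q)} :
    w ∈ patternNeighbors v E ↔
      w ≠ v ∧ ∃ e ∈ E, touches v e = true ∧ (e.1 = w ∨ e.2 = w) := by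
  simp only [patternNeighbors, List.mem_dedup, List.mem_filter, List.mem_flatMap, List.mem_cons,
    List.not_mem_nil, or_false, decide_eq_true_eq, eq_comm (a := w)]
  constructor
  · rintro ⟨⟨e, he, h⟩, hw⟩
    exact ⟨hw, e, he.1, he.2, h⟩
  · rintro ⟨hw, e, he, ht, h⟩
    exact ⟨⟨e, ⟨he, ht⟩, h⟩, hw⟩

omit [DecidableEq Q] in
lemma headD_ne_and_getLastD_ne {v a : Q} (ha : a ≠ v) {l : List Q} (hl : ∀ w ∈ l, w ≠ v) :
    l.headD a ≠ v ∧ l.getLastD a ≠ v := by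
  rcases l with _ | ⟨w, l⟩
  · simpa using ha
  · refine ⟨hl w List.mem_cons_self, ?_⟩
    rw [List.getLastD_cons, List.getLastD_eq_getLast?]
    rcases h : l.getLast? with _ | u
    · exact hl w List.mem_cons_self
    · exact hl u (List.mem_cons_of_mem _ (List.mem_of_getLast? h))

omit [DecidableEq Q] in
lemma eq_headD_or_eq_getLastD {a w : Q} {l : List Q} (hl : l.length ≤ 2) (hw : w ∈ l) :
    w = l.headD a ∨ w = l.getLastD a := by
  match l with
  | [] => simp at hw
  | [u] => simp_all
  | [u, t] => simpa using hw
  | _ :: _ :: _ :: _ => simp at hl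

variable [Fintype Q] {V W : Type*} [Fintype V] [Fintype W]

open Classical in
/-- The maps `Q → V` that send the root `a` to `x` and the root `b` to `y`. -/
noncomputable def rootedMaps (a b : Q) (x y : V) : Finset (Q → V) :=
  Finset.univ.filter fun g => g a = x ∧ g b = y

lemma mem_rootedMaps {a b : Q} {x y : V} {g : Q → V} :
    g ∈ rootedMaps a b x y ↔ g a = x ∧ g b = y := by
  simp [rootedMaps]

lemma sum_rootedMaps_sum_update {a b v : Q} (ha : v ≠ a) (hb : v ≠ b) (x y : V)
    (F : (Q → V) → ℤ) :
    ∑ g ∈ rootedMaps a b x y, ∑ z, F (Function.update g v z) =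
      Fintype.card V * ∑ g ∈ rootedMaps a b x y, F g := by
  have : (Fintype.card V : ℤ) * ∑ g ∈ rootedMaps a b x y, F g =
      ∑ g ∈ rootedMaps a b x y, ∑ _z : V, F g := by
    simp [Finset.mul_sum]
  rw [this, ← Finset.sum_product', ← Finset.sum_product']
  -- `(g, z) ↦ (update g v z, g v)` is an involution
  have hmem : ∀ p ∈ rootedMaps a b x y ×ˢ (Finset.univ : Finset V),
      (Function.update p.1 v p.2, p.1 v) ∈ rootedMaps a b x y ×ˢ (Finset.univ : Finset V) := by
    intro p hp
    simp only [Finset.mem_product, mem_rootedMaps, Finset.mem_univ, and_true] at hp ⊢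
    rwa [Function.update_of_ne ha.symm, Function.update_of_ne hb.symm]
  exact Finset.sum_bij' (fun p _ => (Function.update p.1 v p.2, p.1 v))
    (fun p _ => (Function.update p.1 v p.2, p.1 v)) hmem hmem
    (fun p _ => by simp) (fun p _ => by simp) (fun p _ => rfl)

variable {G : SimpleGraph V} {H : SimpleGraph W} [DecidableRel G.Adj] [DecidableRel H.Adj]
  {n k l m : ℕ}

/-- If the pattern of a kernel product reduces to its roots, then its sum over all maps with
prescribed images of the roots depends only on the type of the pair of these images. -/
lemma sum_rootedMaps_eq_of_reducesTo (hG : G.IsSRGWith n k l m) (hH : H.IsSRGWith n k l m)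
    {a b : Q} {x y : V} {x' y' : W} (hxy : G.pairType x y = H.pairType x' y') (f : ℕ) :
    ∀ (vs : List Q) (E : List (Q × Q)) (F : (Q → V) → ℤ) (F' : (Q → W) → ℤ),
      reducesTo a b f vs E = true → KernelProduct G H E F F' →
      ∑ g ∈ rootedMaps a b x y, F g = ∑ g ∈ rootedMaps a b x' y', F' g := by
  induction f with
  | zero =>
    intro vs E F F' hE hF
    -- `σ` carries `x, y` to `x', y'`, so composition with it matches the two sets of maps
    obtain ⟨σ, hσ⟩ := hG.exists_equiv hH hxy
    have hx : σ x = x' := by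
      have := (hσ x).1
      rw [(pairType_eq_zero G).2 rfl, eq_comm, pairType_eq_zero] at this
      exact this.symm
    have hy : σ y = y' := by
      have := (hσ y).2
      rwa [(pairType_eq_zero G).2 rfl, eq_comm, pairType_eq_zero] at this
    refine Finset.sum_equiv (Equiv.arrowCongr (Equiv.refl Q) σ) (fun g => ?_) (fun g hg => ?_)
    · simp only [mem_rootedMaps, Equiv.arrowCongr_apply, Equiv.refl_symm, Equiv.coe_refl,
        Function.comp_apply, id_eq]
      rw [← hx, ← hy, σ.injective.eq_iff, σ.injective.eq_iff]
    · rw [mem_rootedMaps] at hg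
      refine hF.eq_of_pairType fun e he => ?_
      simp only [reducesTo, List.all_eq_true, Bool.and_eq_true, Bool.or_eq_true,
        decide_eq_true_eq] at hE
      have diag (u : V) : G.pairType u u = H.pairType (σ u) (σ u) := by
        rw [(pairType_eq_zero G).2 rfl, (pairType_eq_zero H).2 rfl]
      have hyx : G.pairType y x = H.pairType (σ y) (σ x) := by
        rw [G.pairType_comm, hxy, hx, hy, H.pairType_comm]
      simp only [Equiv.arrowCongr_apply, Equiv.refl_symm, Equiv.coe_refl, Function.comp_apply,
        id_eq]
      obtain ⟨h1 | h1, h2 | h2⟩ := hE e he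
      · rw [h1, h2]; exact diag _
      · rw [h1, h2, hg.1, hg.2, hx, hy, hxy]
      · rw [h1, h2, hg.1, hg.2, hyx]
      · rw [h1, h2]; exact diag _
  | succ f ih =>
    intro vs E F F' hE hF
    rw [reducesTo] at hE
    split at hE
    · exact absurd hE (by simp)
    · rename_i v hfind
      have hv := List.find?_some hfind
      simp only [Bool.and_eq_true, decide_eq_true_eq] at hv
      obtain ⟨⟨hva, hvb⟩, hlen⟩ := hv
      obtain ⟨hp, hq⟩ := headD_ne_and_getLastD_ne hva.symm (l := patternNeighbors v E)
        fun w hw => (mem_patternNeighbors.1 hw).1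
      have hend (w : Q) (hw : ∃ e ∈ E, touches v e = true ∧ (e.1 = w ∨ e.2 = w)) :
          w = v ∨ w = (patternNeighbors v E).headD a ∨ w = (patternNeighbors v E).getLastD a := by
        by_cases hwv : w = v
        · exact Or.inl hwv
        · exact Or.inr (eq_headD_or_eq_getLastD hlen (mem_patternNeighbors.2 ⟨hwv, hw⟩))
      have key := ih _ _ _ _ hE <| hF.sum_update hG hH hp hq fun e he ht =>
        ⟨hend _ ⟨e, he, ht, Or.inl rfl⟩, hend _ ⟨e, he, ht, Or.inr rfl⟩⟩
      rw [sum_rootedMaps_sum_update hva hvb, sum_rootedMaps_sum_update hva hvb, hG.card,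
        hH.card] at key
      -- the sum over the old images of `v` contributes the factor `n`, which is cancelled here
      have hn : (n : ℤ) ≠ 0 := by
        rw [← hG.card]
        exact_mod_cast (Fintype.card_pos_iff.2 ⟨x⟩).ne'
      exact mul_left_cancel₀ hn key

end Elimination

/-! ### Quotients of a pattern -/

section Quotient

/-- Whether `P` holds for all extensions of the map `c` from the vertices processed so far to the
vertices of the list, where a new vertex is sent to itself or to one of the fixed points `reps`
found before. -/
def forallClassMaps {Q : Type*} [DecidableEq Q] (P : (Q → Q) → Bool) :
    List Q → List Q → (Q → Q) → Bool
  | [], _, c => P c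
  | i :: is, reps, c => forallClassMaps P is (i :: reps) c &&
      reps.all fun j => forallClassMaps P is reps (Function.update c i j)

/-- `forallClassMaps` covers every idempotent `c` that moves no vertex upwards. -/
lemma of_forallClassMaps {Q : Type*} [LinearOrder Q] {P : (Q → Q) → Bool} {c : Q → Q}
    (hle : ∀ i, c i ≤ i) (hc : ∀ i, c (c i) = c i) (is : List Q) :
    ∀ (reps : List Q) (d : Q → Q), forallClassMaps P is reps d = true → is.Pairwise (· < ·) →
      (∀ i ∉ is, d i = c i) → (∀ i ∈ is, d i = i) → (∀ j ∉ is, c j = j → j ∈ reps) →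
      P c = true := by
  induction is with
  | nil =>
    intro reps d h _ hd _ _
    rw [← show d = c from funext fun i => hd i List.not_mem_nil]
    exact h
  | cons i is ih =>
    intro reps d h hs hd hid hreps
    rw [forallClassMaps, Bool.and_eq_true, List.all_eq_true] at h
    rw [List.pairwise_cons] at hs
    rcases (hle i).eq_or_lt with hi | hi
    · refine ih _ _ h.1 hs.2 (fun j hj => ?_) (fun j hj => hid j (List.mem_cons_of_mem _ hj))
        (fun j hj hcj => ?_)
      · by_cases hji : j = i
        · rw [hji, hi, hid i List.mem_cons_self]
        · exact hd j (by simp [hji, hj])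
      · by_cases hji : j = i
        · simp [hji]
        · exact List.mem_cons_of_mem _ (hreps j (by simp [hji, hj]) hcj)
    · have hci : c i ∉ i :: is := by
        rw [List.mem_cons, not_or]
        exact ⟨hi.ne, fun hmem => (hs.1 _ hmem).not_gt hi⟩
      refine ih _ _ (h.2 _ (hreps _ hci (hc i))) hs.2 (fun j hj => ?_) (fun j hj => ?_)
        (fun j hj hcj => hreps j ?_ hcj)
      · by_cases hji : j = i
        · rw [hji, Function.update_self]
        · rw [Function.update_of_ne hji]
          exact hd j (by simp [hji, hj])
      · rw [Function.update_of_ne (hs.1 j hj).ne']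
        exact hid j (List.mem_cons_of_mem _ hj)
      · rw [List.mem_cons, not_or]
        refine ⟨?_, hj⟩
        rintro rfl
        exact hi.ne hcj

variable {s : ℕ}

/-- The edges of the quotient of `E` by the class map `c`, drawn on the class representatives,
together with an edge from each other vertex to the representative of its class. -/
def quotientPattern (E : List (Fin s × Fin s)) (c : Fin s → Fin s) : List (Fin s × Fin s) :=
  E.map (fun e => (c e.1, c e.2)) ++
    ((List.finRange s).filter fun i => decide (c i ≠ i)).map fun i => (i, c i)

/-- Whether all loopless quotients of the pattern `E` can be reduced to the roots `a` and `b`. -/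
def allQuotientsReduce (E : List (Fin s × Fin s)) (a b : Fin s) : Bool :=
  forallClassMaps (fun c => E.any (fun e => decide (c e.1 = c e.2)) ||
    reducesTo a b (s - 2) (List.finRange s) (quotientPattern E c)) (List.finRange s) [] id

/-- The least element of the class of `i`. -/
noncomputable def classMin (r : Setoid (Fin s)) (i : Fin s) : Fin s :=
  open Classical in
  (Finset.univ.filter fun j => r i j).min' ⟨i, by simp⟩

lemma classMin_rel (r : Setoid (Fin s)) (i : Fin s) : r i (classMin r i) := by
  classical
  have := Finset.min'_mem (Finset.univ.filter fun j => r i j) ⟨i, by simp⟩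
  exact (Finset.mem_filter.1 this).2

lemma classMin_le (r : Setoid (Fin s)) (i : Fin s) : classMin r i ≤ i :=
  Finset.min'_le _ _ (by simp)

lemma classMin_eq {r : Setoid (Fin s)} {i j : Fin s} (h : r i j) :
    classMin r i = classMin r j := by
  classical
  have : (Finset.univ.filter fun t => r i t) = Finset.univ.filter fun t => r j t := by
    ext t
    simp only [Finset.mem_filter, Finset.mem_univ, true_and]
    exact ⟨r.trans' (r.symm' h), r.trans' h⟩
  simp only [classMin, this]

lemma le_ker_iff {V : Type*} {r : Setoid (Fin s)} {g : Fin s → V} :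
    r ≤ Setoid.ker g ↔ ∀ i, g i = g (classMin r i) := by
  constructor
  · exact fun h i => h (classMin_rel r i)
  · intro h i j hij
    rw [Setoid.ker_def, h i, h j, classMin_eq hij]

end Quotient

/-! ### Counting injective homomorphisms -/

section Count

variable {V W : Type*} {G : SimpleGraph V} {H : SimpleGraph W}

open Classical in
lemma KernelProduct.adj {Q : Type*} (E : List (Q × Q)) :
    KernelProduct G H E (fun g => if ∀ e ∈ E, G.Adj (g e.1) (g e.2) then 1 else 0)
      (fun g => if ∀ e ∈ E, H.Adj (g e.1) (g e.2) then 1 else 0) := by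
  induction E with
  | nil => simpa using KernelProduct.nil
  | cons e E ih =>
    simpa [← ite_and, List.forall_mem_cons, and_comm] using ih.cons e.1 e.2 Matched.adj

open Classical in
lemma KernelProduct.eq {Q : Type*} (E : List (Q × Q)) :
    KernelProduct G H E (fun g => if ∀ e ∈ E, g e.1 = g e.2 then 1 else 0)
      (fun g => if ∀ e ∈ E, g e.1 = g e.2 then 1 else 0) := by
  induction E with
  | nil => simpa using KernelProduct.nil
  | cons e E ih =>
    simpa [← ite_and, List.forall_mem_cons, and_comm] using ih.cons e.1 e.2 Matched.eq

variable [Fintype V] [Fintype W] {s : ℕ}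

variable (G) in
open Classical in
/-- The maps from the vertices of the pattern `E` to `G` that preserve adjacency and send the roots
`a` and `b` to `x` and `y`. -/
noncomputable def rootedHoms (E : List (Fin s × Fin s)) (a b : Fin s) (x y : V) :
    Finset (Fin s → V) :=
  (rootedMaps a b x y).filter fun g => ∀ e ∈ E, G.Adj (g e.1) (g e.2)

variable {E : List (Fin s × Fin s)} {a b : Fin s}

open Classical in
lemma card_rootedHoms_le_ker_eq_zero {r : Setoid (Fin s)}
    (h : ∃ e ∈ E, classMin r e.1 = classMin r e.2) (x y : V) :
    ((rootedHoms G E a b x y).filter fun g => r ≤ Setoid.ker g).card = 0 := by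
  rw [Finset.card_eq_zero, Finset.filter_eq_empty_iff]
  intro g hg hr
  obtain ⟨e, he, h⟩ := h
  refine ((Finset.mem_filter.1 hg).2 e he).ne ?_
  rw [le_ker_iff.1 hr e.1, le_ker_iff.1 hr e.2, h]

open Classical in
/-- The homomorphisms constant on the classes of `r`, counted by a kernel product on the quotient
pattern: adjacency along the edges between representatives, equality with the representative
elsewhere. -/
lemma card_rootedHoms_le_ker (r : Setoid (Fin s)) (x y : V) :
    (((rootedHoms G E a b x y).filter fun g => r ≤ Setoid.ker g).card : ℤ) =
      ∑ g ∈ rootedMaps a b x y,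
        (if ∀ e ∈ E.map (fun e => (classMin r e.1, classMin r e.2)), G.Adj (g e.1) (g e.2)
          then 1 else 0) *
        (if ∀ e ∈ ((List.finRange s).filter fun i => decide (classMin r i ≠ i)).map
          fun i => (i, classMin r i), g e.1 = g e.2 then 1 else 0) := by
  rw [rootedHoms, Finset.filter_filter, Finset.card_filter, Nat.cast_sum]
  refine Finset.sum_congr rfl fun g _ => ?_
  have hr : (∀ e ∈ ((List.finRange s).filter fun i => decide (classMin r i ≠ i)).map
      fun i => (i, classMin r i), g e.1 = g e.2) ↔ r ≤ Setoid.ker g := by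
    rw [le_ker_iff]
    constructor
    · intro h i
      by_cases hi : classMin r i = i
      · rw [hi]
      · exact h (i, classMin r i) (List.mem_map.2 ⟨i, by simp [hi], rfl⟩)
    · intro h e he
      obtain ⟨i, -, rfl⟩ := List.mem_map.1 he
      exact h i
  have ha (hr : r ≤ Setoid.ker g) :
      (∀ e ∈ E.map (fun e => (classMin r e.1, classMin r e.2)), G.Adj (g e.1) (g e.2)) ↔
        ∀ e ∈ E, G.Adj (g e.1) (g e.2) := by
    rw [le_ker_iff] at hr
    simp only [List.forall_mem_map, ← hr]
  simp only [hr]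
  by_cases h : r ≤ Setoid.ker g
  · simp only [ha h, h, and_true, if_true, mul_one, Nat.cast_ite, Nat.cast_one, Nat.cast_zero]
  · simp only [h, and_false, if_false, mul_zero, Nat.cast_zero]

variable [DecidableRel G.Adj] [DecidableRel H.Adj] {n k l m : ℕ}

open Classical in
lemma card_rootedHoms_le_ker_eq (hG : G.IsSRGWith n k l m) (hH : H.IsSRGWith n k l m)
    {x y : V} {x' y' : W} (hxy : G.pairType x y = H.pairType x' y')
    (hE : allQuotientsReduce E a b = true) (r : Setoid (Fin s)) :
    ((rootedHoms G E a b x y).filter fun g => r ≤ Setoid.ker g).card =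
      ((rootedHoms H E a b x' y').filter fun g => r ≤ Setoid.ker g).card := by
  have key := of_forallClassMaps (c := classMin r) (classMin_le r)
    (fun i => (classMin_eq (classMin_rel r i)).symm) _ _ _ hE (List.pairwise_lt_finRange s)
    (fun i hi => absurd (List.mem_finRange i) hi) (fun _ _ => rfl)
    (fun j hj => absurd (List.mem_finRange j) hj)
  rw [Bool.or_eq_true, List.any_eq_true] at key
  rcases key with key | key
  · simp only [decide_eq_true_eq] at key
    rw [card_rootedHoms_le_ker_eq_zero key, card_rootedHoms_le_ker_eq_zero key]
  · have := sum_rootedMaps_eq_of_reducesTo hG hH hxy _ _ _ _ _ key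
      ((KernelProduct.adj _).append (KernelProduct.eq _))
    have h : (((rootedHoms G E a b x y).filter fun g => r ≤ Setoid.ker g).card : ℤ) =
        ((rootedHoms H E a b x' y').filter fun g => r ≤ Setoid.ker g).card :=
      (card_rootedHoms_le_ker r x y).trans
        (Eq.trans (by convert this) (card_rootedHoms_le_ker r x' y').symm)
    exact_mod_cast h

lemma finite_setoid (α : Type*) [Finite α] : Finite (Setoid α) :=
  Finite.of_injective (fun r : Setoid α => (r : α → α → Prop)) fun _ _ h => Setoid.eq_iff_rel_eq.2 h

open Classical in
/-- Maps sorted by their kernel, the finest admissible kernel being split off. -/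
lemma card_filter_le_ker {Q U : Type*} [Fintype (Setoid Q)] (r : Setoid Q)
    (S : Finset (Q → U)) :
    (S.filter fun g => r ≤ Setoid.ker g).card =
      (S.filter fun g => Setoid.ker g = r).card +
        ∑ t ∈ Finset.univ.filter (r < ·), (S.filter fun g => Setoid.ker g = t).card := by
  rw [Finset.card_eq_sum_card_fiberwise (f := fun g => Setoid.ker g)
    (t := Finset.univ.filter (r ≤ ·)) (fun g hg => by simpa using (Finset.mem_filter.1 hg).2)]
  have hsplit : Finset.univ.filter (r ≤ ·) = insert r (Finset.univ.filter (r < ·)) := by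
    ext t
    simp [le_iff_eq_or_lt, eq_comm]
  rw [hsplit, Finset.sum_insert (by simp)]
  congr 1
  · congr 1
    ext g
    simp only [Finset.mem_filter]
    exact ⟨fun h => ⟨h.1.1, h.2⟩, fun h => ⟨⟨h.1, h.2.ge⟩, h.2⟩⟩
  · refine Finset.sum_congr rfl fun t ht => ?_
    congr 1
    ext g
    simp only [Finset.mem_filter]
    exact ⟨fun h => ⟨h.1.1, h.2⟩, fun h =>
      ⟨⟨h.1, h.2 ▸ (Finset.mem_filter.1 ht).2.le⟩, h.2⟩⟩

open Classical in
/-- Möbius inversion over the lattice of equivalence relations: the homomorphisms with a given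
kernel are those whose kernel is at least as coarse, minus those whose kernel is coarser. -/
lemma card_rootedHoms_ker_eq (hG : G.IsSRGWith n k l m) (hH : H.IsSRGWith n k l m)
    {x y : V} {x' y' : W} (hxy : G.pairType x y = H.pairType x' y')
    (hE : allQuotientsReduce E a b = true) (r : Setoid (Fin s)) :
    ((rootedHoms G E a b x y).filter fun g => Setoid.ker g = r).card =
      ((rootedHoms H E a b x' y').filter fun g => Setoid.ker g = r).card := by
  have := finite_setoid (Fin s)
  induction r using WellFoundedGT.induction with
  | ind r ih =>
  have := Fintype.ofFinite (Setoid (Fin s))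
  have total := card_rootedHoms_le_ker_eq hG hH hxy hE r
  rw [card_filter_le_ker, card_filter_le_ker,
    Finset.sum_congr rfl fun t ht => ih t (Finset.mem_filter.1 ht).2] at total
  exact Nat.add_right_cancel total

open Classical in
lemma card_injective_rootedHoms_eq (hG : G.IsSRGWith n k l m) (hH : H.IsSRGWith n k l m)
    {x y : V} {x' y' : W} (hxy : G.pairType x y = H.pairType x' y')
    (hE : allQuotientsReduce E a b = true) :
    ((rootedHoms G E a b x y).filter Function.Injective).card =
      ((rootedHoms H E a b x' y').filter Function.Injective).card := by
  simpa only [← Setoid.ker_eq_bot_iff] using card_rootedHoms_ker_eq hG hH hxy hE ⊥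

end Count

/-! ### From subgraphs to injective homomorphisms -/

section Copies

variable {Q V : Type*} {F : SimpleGraph Q} {G : SimpleGraph V}

/-- Subgraphs with a marked isomorphism from `F` are the same as copies of `F`, and the marked
isomorphisms of a given subgraph form a torsor under those automorphisms of `F` that respect the
marking condition `C`. -/
lemma card_copies_eq_mul_ncard (C : (Q → V) → Prop) (A : (F ≃g F) → Prop)
    (hC : ∀ f : F.Copy G, C f → ∀ σ : F ≃g F, C (f ∘ σ) ↔ A σ) :
    Nat.card {f : F.Copy G // C f} =
      Set.ncard {S : G.Subgraph | ∃ e : F ≃g S.coe, C fun i => (e i : V)} *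
        Nat.card {σ : F ≃g F // A σ} := by
  let toCopy (S : G.Subgraph) (e : F ≃g S.coe) : F.Copy G :=
    ⟨S.hom.comp e.toHom, Subgraph.hom_injective.comp e.injective⟩
  have toCopy_apply (S : G.Subgraph) (e : F ≃g S.coe) (i : Q) : toCopy S e i = e i := rfl
  have toSubgraph_toCopy (S : G.Subgraph) (e : F ≃g S.coe) : (toCopy S e).toSubgraph = S := by
    simp [toCopy, Copy.toSubgraph, Subgraph.map_comp]
  let 𝒮 := {S : G.Subgraph | ∃ e : F ≃g S.coe, C fun i => (e i : V)}
  let T := Σ S : 𝒮, {e : F ≃g S.1.coe // C fun i => (e i : V)}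
  have e₁ : T ≃ {f : F.Copy G // C f} := by
    refine Equiv.ofBijective (fun t => ⟨toCopy t.1.1 t.2.1, t.2.2⟩) ⟨?_, ?_⟩
    · rintro ⟨⟨S, hS⟩, e, he⟩ ⟨⟨S', hS'⟩, e', he'⟩ h
      have h : toCopy S e = toCopy S' e' := congrArg Subtype.val h
      obtain rfl : S = S' := by
        rw [← toSubgraph_toCopy S e, h, toSubgraph_toCopy]
      obtain rfl : e = e' := by
        ext i
        rw [← toCopy_apply, h, toCopy_apply]
      rfl
    · rintro ⟨f, hf⟩
      exact ⟨⟨⟨f.toSubgraph, f.isoToSubgraph, hf⟩, f.isoToSubgraph, hf⟩, rfl⟩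
  have e₂ (S : 𝒮) : {e : F ≃g S.1.coe // C fun i => (e i : V)} ≃ {σ : F ≃g F // A σ} :=
    { toFun := fun e => ⟨e.1.trans S.2.choose.symm, by
        rw [← hC (toCopy S.1 S.2.choose) S.2.choose_spec]
        have : ⇑(toCopy S.1 S.2.choose) ∘ ⇑(e.1.trans S.2.choose.symm) = fun i => (e.1 i : V) := by
          funext i
          simp [toCopy_apply]
        rw [this]
        exact e.2⟩
      invFun := fun σ => ⟨σ.1.trans S.2.choose,
        (hC (toCopy S.1 S.2.choose) S.2.choose_spec σ.1).2 σ.2⟩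
      left_inv := fun e => by
        ext i
        simp
      right_inv := fun σ => by
        ext i
        simp }
  rw [← Nat.card_congr e₁, Nat.card_congr (Equiv.sigmaCongrRight e₂),
    Nat.card_congr (Equiv.sigmaEquivProd _ _), Nat.card_prod, Nat.card_coe_set_eq]

open Classical in
lemma card_rooted_copies_eq [Fintype V] {s : ℕ} {F : SimpleGraph (Fin s)}
    {E : List (Fin s × Fin s)} (hE : ∀ i j, F.Adj i j ↔ (i, j) ∈ E ∨ (j, i) ∈ E)
    (a b : Fin s) (x y : V) :
    Nat.card {f : F.Copy G // f a = x ∧ f b = y} =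
      ((rootedHoms G E a b x y).filter Function.Injective).card := by
  rw [← Nat.card_eq_finsetCard]
  refine Nat.card_congr
    { toFun := fun f => ⟨f.1, ?_⟩
      invFun := fun g => ⟨⟨⟨g.1, fun {i j} h => ?_⟩, (Finset.mem_filter.1 g.2).2⟩, ?_⟩
      left_inv := fun f => rfl
      right_inv := fun g => rfl }
  · simp only [rootedHoms, Finset.mem_filter, mem_rootedMaps]
    exact ⟨⟨f.2, fun e he => f.1.toHom.map_rel ((hE _ _).2 (Or.inl he))⟩, f.1.injective⟩
  · have hg := (Finset.mem_filter.1 (Finset.mem_filter.1 g.2).1).2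
    exact ((hE i j).1 h).elim (fun h => hg _ h) fun h => (hg _ h).symm
  · exact mem_rootedMaps.1 (Finset.mem_filter.1 (Finset.mem_filter.1 g.2).1).1

variable [Fintype V] {W : Type*} [Fintype W] {H : SimpleGraph W}
  [DecidableRel G.Adj] [DecidableRel H.Adj] {n k l m : ℕ}

lemma card_rooted_copies_congr (hG : G.IsSRGWith n k l m) (hH : H.IsSRGWith n k l m)
    {s : ℕ} {F : SimpleGraph (Fin s)} {E : List (Fin s × Fin s)}
    (hE : ∀ i j, F.Adj i j ↔ (i, j) ∈ E ∨ (j, i) ∈ E) {a b : Fin s} {x y : V} {x' y' : W}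
    (hxy : G.pairType x y = H.pairType x' y') (h : allQuotientsReduce E a b = true) :
    Nat.card {f : F.Copy G // f a = x ∧ f b = y} =
      Nat.card {f : F.Copy H // f a = x' ∧ f b = y'} := by
  rw [card_rooted_copies_eq hE, card_rooted_copies_eq hE,
    card_injective_rootedHoms_eq hG hH hxy h]

end Copies

/-! ### Paths -/

section Paths

/-- The edges of the path on `0, …, s - 1`. -/
def pathPattern (s : ℕ) : List (Fin s × Fin s) :=
  (List.finRange s ×ˢ List.finRange s).filter fun e => decide (e.1.val + 1 = e.2.val)

lemma pathGraph_adj_iff_mem {s : ℕ} (i j : Fin s) :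
    (pathGraph s).Adj i j ↔ (i, j) ∈ pathPattern s ∨ (j, i) ∈ pathPattern s := by
  simp [pathGraph_adj, pathPattern]

set_option maxRecDepth 100000 in
/-- Together with an edge between the roots, a quotient of the path is a multigraph with at most
seven edges and even degrees. A `K₄` minor needs four vertices of degree at least three, hence at
least four, and thus eight edges. So none of these multigraphs has a `K₄` minor, and the reduction
succeeds for each of them; this is verified by evaluation. -/
lemma allQuotientsReduce_pathPattern (s : ℕ) (hs : s < 6) :
    allQuotientsReduce (pathPattern (s + 2)) 0 (Fin.last (s + 1)) = true := by
  interval_cases s <;> clear hs <;> decide +kernel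

variable {V W : Type*} {G : SimpleGraph V} {H : SimpleGraph W}

lemma numPathsBetween_eq_zero {s : ℕ} (hs : s < 2) {x y : V} (hxy : x ≠ y) :
    G.numPathsBetween s x y = 0 := by
  rw [numPathsBetween, Set.eq_empty_of_forall_notMem (s := {S : G.Subgraph | _}), Set.ncard_empty]
  rintro S ⟨e, ⟨i, hi, hx⟩, ⟨j, hj, hy⟩⟩
  rw [show i = j from Fin.ext (by omega), hy] at hx
  exact hxy hx.symm

/-- The number of paths times the number of automorphisms of the path that fix both ends (which is
one, but this is not needed) is the number of rooted copies of the path. -/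
lemma card_rooted_path_copies (s : ℕ) (x y : V) :
    Nat.card {f : (pathGraph (s + 2)).Copy G // f 0 = x ∧ f (Fin.last (s + 1)) = y} =
      G.numPathsBetween (s + 2) x y * Nat.card {σ : pathGraph (s + 2) ≃g pathGraph (s + 2) //
        σ 0 = 0 ∧ σ (Fin.last (s + 1)) = (Fin.last (s + 1))} := by
  rw [card_copies_eq_mul_ncard (fun g : Fin (s + 2) → V => g 0 = x ∧
    g (Fin.last (s + 1)) = y) (fun σ => σ 0 = 0 ∧
      σ (Fin.last (s + 1)) = (Fin.last (s + 1))), numPathsBetween]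
  · congr 2
    ext S
    refine exists_congr fun e => and_congr ⟨fun h => ⟨_, rfl, h⟩, ?_⟩ ⟨fun h => ⟨_, rfl, h⟩, ?_⟩
    · rintro ⟨i, hi, h⟩
      rwa [show i = 0 from Fin.ext hi] at h
    · rintro ⟨i, hi, h⟩
      rwa [show i = (Fin.last (s + 1)) from Fin.ext (by simpa using hi)] at h
  · rintro f ⟨rfl, rfl⟩ σ
    exact and_congr f.injective.eq_iff f.injective.eq_iff

variable [Fintype V] [Fintype W] [DecidableRel G.Adj] [DecidableRel H.Adj] {n k l m : ℕ}

lemma numPathsBetween_congr (hG : G.IsSRGWith n k l m) (hH : H.IsSRGWith n k l m)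
    {x y : V} {x' y' : W} (hne : x ≠ y) (hne' : x' ≠ y')
    (hxy : G.pairType x y = H.pairType x' y') {s : ℕ} (hs : s ≤ 7) :
    G.numPathsBetween s x y = H.numPathsBetween s x' y' := by
  rcases lt_or_ge s 2 with h | h
  · rw [numPathsBetween_eq_zero h hne, numPathsBetween_eq_zero h hne']
  · obtain ⟨s, rfl⟩ := Nat.exists_eq_add_of_le' h
    have key := card_rooted_copies_congr hG hH pathGraph_adj_iff_mem hxy
      (allQuotientsReduce_pathPattern s (by omega))
    rw [card_rooted_path_copies, card_rooted_path_copies] at key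
    have : Finite (pathGraph (s + 2) ≃g pathGraph (s + 2)) := DFunLike.finite _
    refine Nat.eq_of_mul_eq_mul_right (Nat.card_pos_iff.2 ⟨?_, inferInstance⟩) key
    exact ⟨⟨RelIso.refl _, rfl, rfl⟩⟩

end Paths

/-! ### Cycles -/

section Cycles

/-- The edges of the cycle on `0, …, s - 1`. -/
def cyclePattern (s : ℕ) : List (Fin s × Fin s) :=
  (List.finRange s ×ˢ List.finRange s).filter fun e => decide ((e.2 - e.1).val = 1)

lemma cycleGraph_adj_iff_mem {s : ℕ} (i j : Fin s) :
    (cycleGraph s).Adj i j ↔ (i, j) ∈ cyclePattern s ∨ (j, i) ∈ cyclePattern s := by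
  simp [cycleGraph_adj', cyclePattern, or_comm]

set_option maxRecDepth 100000 in
/-- A cycle of length at most five together with an edge between the roots has at most six edges, so
that a quotient with a `K₄` minor would be `K₄` itself; but identifications of vertices of degrees
`2, 2, 2, 3, 3` never lead to four vertices of degree `3`. As for paths, the reductions are verified
by evaluation. -/
lemma allQuotientsReduce_cyclePattern {s : ℕ} (hs : s ≤ 5) :
    ∀ a b : Fin s, a ≠ b → allQuotientsReduce (cyclePattern s) a b = true := by
  interval_cases s <;> clear hs <;> decide +kernel

variable {V W : Type*} {G : SimpleGraph V} {H : SimpleGraph W}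

/-- The number of cycles through `x` and `y` times the number of automorphisms of the cycle is the
number of copies of the cycle through `x` and `y`, sorted by the positions of `x` and `y`. -/
lemma sum_card_rooted_cycle_copies [Finite V] (s : ℕ) (x y : V) :
    ∑ p : Fin s × Fin s, Nat.card {f : (cycleGraph s).Copy G // f p.1 = x ∧ f p.2 = y} =
      G.numCyclesThrough s x y * Nat.card (cycleGraph s ≃g cycleGraph s) := by
  have : Finite ((cycleGraph s).Copy G) := DFunLike.finite _
  have e : (Σ p : Fin s × Fin s, {f : (cycleGraph s).Copy G // f p.1 = x ∧ f p.2 = y}) ≃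
      {f : (cycleGraph s).Copy G // (∃ i, f i = x) ∧ ∃ j, f j = y} := by
    refine Equiv.ofBijective (fun t => ⟨t.2.1, ⟨_, t.2.2.1⟩, ⟨_, t.2.2.2⟩⟩) ⟨?_, ?_⟩
    · rintro ⟨⟨i, j⟩, f, hi, hj⟩ ⟨⟨i', j'⟩, f', hi', hj'⟩ h
      obtain rfl : f = f' := congrArg Subtype.val h
      obtain rfl : i = i' := f.injective (hi.trans hi'.symm)
      obtain rfl : j = j' := f.injective (hj.trans hj'.symm)
      rfl
    · rintro ⟨f, ⟨i, hi⟩, ⟨j, hj⟩⟩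
      exact ⟨⟨(i, j), f, hi, hj⟩, rfl⟩
  rw [← Nat.card_sigma, Nat.card_congr e,
    card_copies_eq_mul_ncard (fun g : Fin s → V => (∃ i, g i = x) ∧ ∃ j, g j = y) (fun _ => True),
    numCyclesThrough]
  · congr 1
    · congr 1
      ext S
      constructor
      · rintro ⟨e, ⟨i, hi⟩, ⟨j, hj⟩⟩
        exact ⟨⟨e⟩, hi ▸ (e i).2, hj ▸ (e j).2⟩
      · rintro ⟨⟨e⟩, hx, hy⟩
        exact ⟨e, ⟨e.symm ⟨x, hx⟩, by simp⟩, ⟨e.symm ⟨y, hy⟩, by simp⟩⟩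
    · exact Nat.card_congr (Equiv.subtypeUnivEquiv fun _ => trivial)
  · rintro f ⟨⟨i, hi⟩, ⟨j, hj⟩⟩ σ
    exact iff_true_intro ⟨⟨σ.symm i, by simp [hi]⟩, ⟨σ.symm j, by simp [hj]⟩⟩

variable [Fintype V] [Fintype W] [DecidableRel G.Adj] [DecidableRel H.Adj] {n k l m : ℕ}

lemma numCyclesThrough_congr (hG : G.IsSRGWith n k l m) (hH : H.IsSRGWith n k l m)
    {x y : V} {x' y' : W} (hne : x ≠ y) (hne' : x' ≠ y')
    (hxy : G.pairType x y = H.pairType x' y') {s : ℕ} (hs : s ≤ 5) :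
    G.numCyclesThrough s x y = H.numCyclesThrough s x' y' := by
  have key : ∑ p : Fin s × Fin s,
      Nat.card {f : (cycleGraph s).Copy G // f p.1 = x ∧ f p.2 = y} =
      ∑ p : Fin s × Fin s, Nat.card {f : (cycleGraph s).Copy H // f p.1 = x' ∧ f p.2 = y'} := by
    refine Finset.sum_congr rfl fun p _ => ?_
    by_cases hp : p.1 = p.2
    · have h1 : IsEmpty {f : (cycleGraph s).Copy G // f p.1 = x ∧ f p.2 = y} :=
        ⟨fun f => hne (f.2.1.symm.trans ((congrArg _ hp).trans f.2.2))⟩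
      have h2 : IsEmpty {f : (cycleGraph s).Copy H // f p.1 = x' ∧ f p.2 = y'} :=
        ⟨fun f => hne' (f.2.1.symm.trans ((congrArg _ hp).trans f.2.2))⟩
      rw [Nat.card_of_isEmpty, Nat.card_of_isEmpty]
    · exact card_rooted_copies_congr hG hH cycleGraph_adj_iff_mem hxy
        (allQuotientsReduce_cyclePattern hs _ _ hp)
  rw [sum_card_rooted_cycle_copies, sum_card_rooted_cycle_copies] at key
  have : Finite (cycleGraph s ≃g cycleGraph s) := DFunLike.finite _
  exact Nat.eq_of_mul_eq_mul_right (Nat.card_pos_iff.2 ⟨⟨RelIso.refl _⟩, inferInstance⟩) key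

end Cycles

end SimpleGraph

theorem mainTheorem1 {V : Type*} [Fintype V] {W : Type*} [Fintype W]
    (G : SimpleGraph V) [DecidableRel G.Adj] (H : SimpleGraph W) [DecidableRel H.Adj]
    (n k l m : ℕ) (hG : G.IsSRGWith n k l m) (hH : H.IsSRGWith n k l m)
    (x y : V) (hxy : x ≠ y) (x' y' : W) (hxy' : x' ≠ y')
    (hadj : G.Adj x y ↔ H.Adj x' y') :
    (∀ s : ℕ, s ≤ 7 → G.numPathsBetween s x y = H.numPathsBetween s x' y') ∧
    (∀ s : ℕ, 3 ≤ s → s ≤ 5 → G.numCyclesThrough s x y = H.numCyclesThrough s x' y') := by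
  have htype : G.pairType x y = H.pairType x' y' := by
    by_cases h : G.Adj x y
    · rw [(SimpleGraph.pairType_eq_one G).2 h, (SimpleGraph.pairType_eq_one H).2 (hadj.1 h)]
    · simp only [SimpleGraph.pairType, if_neg hxy, if_neg hxy', if_neg h,
        if_neg (mt hadj.2 h)]
  exact ⟨fun s hs => SimpleGraph.numPathsBetween_congr hG hH hxy hxy' htype hs,
    fun s _ hs => SimpleGraph.numCyclesThrough_congr hG hH hxy hxy' htype hs⟩
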